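/- Let $\mathcal G$ be a finite connected plane graph (loops and multiple edges allowed) in which every edge $e$ has a conductance $c_e>0$, with $n\ge 1$ distinct vertices on the outer face, called nodes and numbered $1,\dots,n$ counterclockwise; indices of nodes are taken modulo $n$. Draw $\mathcal G$ in a disk and join the nodes, by disjoint legs in the outer face, to $n$ points in counterclockwise order on the boundary circle. The dual graph $\mathcal G^*$ has one vertex for each bounded face of $\mathcal G$ and one vertex for each of the $n$ parts into which the legs cut the region between $\mathcal G$ and the circle; the latter are its nodes, and $i'$ denotes the part which meets the circle between nodes $i$ and $i+1$. Each edge $e$ of $\mathcal G$ is crossed by one edge of $\mathcal G^*$, which joins the faces on the two sides of $e$ and has conductance $1/c_e$. The response matrix of such a network is the matrix, indexed by the nodes, that sends each vector $v$ of potentials at the nodes to the vector of net currents out of the network at the nodes, when the potentials at the internal vertices are such that no current is lost there; the current out at a vertex $x$ is $\sum_{e=xy}c_e\,(f(y)-f(x))$ for the potential $f$. Let $L$ and $L^*$ be the response matrices of $\mathcal G$ and $\mathcal G^*$ (both exist and are unique), and let $\delta_i$ be the $i$-th standard basis vector of $\mathbb R^n$. Then for all $i,j$ the vector $\delta_j-\delta_{j+1}$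 is in the image of $L$, the vector $\delta_i-\delta_{i+1}$ is orthogonal to the kernel of $L$, and $$L^*_{i',j'}=(\delta_i-\delta_{i+1})^{T}L^{-1}(\delta_j-\delta_{j+1}),$$ where $L^{-1}(\delta_j-\delta_{j+1})$ stands for any vector $w$ with $Lw=\delta_j-\delta_{j+1}$; the right-hand side does not depend on the choice of $w$. -/

import Mathlib

open scoped Matrix

/-- A resistor network with vertex set `V` and nodes indexed by `ι`. Every undirected edge is a
pair of opposite darts `d`, `rev d`; loops and parallel edges are allowed. -/
structure ResistorNetwork (V D ι : Type*) where
  /-- the vertex at which a dart starts -/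
  origin : D → V
  rev : D → D
  rev_rev : ∀ d, rev (rev d) = d
  rev_ne : ∀ d, rev d ≠ d
  conductance : D → ℝ
  conductance_pos : ∀ d, 0 < conductance d
  conductance_rev : ∀ d, conductance (rev d) = conductance d
  node : ι → V

namespace ResistorNetwork

variable {V D ι : Type*} [Fintype D]

open Classical in
/-- For the potential `f`, the net current that arrives at `v` through the edges (and leaves the
network there): the sum over the edges at `v` of conductance times potential difference. -/
noncomputable def netCurrent (N : ResistorNetwork V D ι) (f : V → ℝ) (v : V) : ℝ :=
  ∑ d : D, if N.origin d = v then N.conductance d * (f (N.origin (N.rev d)) - f v) else 0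

/-- No current is lost at the internal vertices, that is, the vertices that are not nodes. -/
def IsHarmonic (N : ResistorNetwork V D ι) (f : V → ℝ) : Prop :=
  ∀ v, v ∉ Set.range N.node → N.netCurrent f v = 0

/-- `L` is the response matrix: it sends the potentials at the nodes to the net currents out of
the network at the nodes, when no current is lost at the internal vertices. With this sign the
off-diagonal entries of `L` are nonnegative and `L` is negative semidefinite. -/
def IsResponseMatrix [Fintype ι] (N : ResistorNetwork V D ι) (L : Matrix ι ι ℝ) : Prop :=
  ∀ f : V → ℝ, N.IsHarmonic f → L *ᵥ (fun i => f (N.node i)) = fun i => N.netCurrent f (N.node i)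

end ResistorNetwork

/-- A weighted graph with `n` nodes drawn on an oriented surface with boundary circle, given by its
rotation system. `D` is the set of darts (oriented edges). From node `i` a leg, `Sum.inr i`, leads
to the `i`-th of `n` points that follow each other counterclockwise on the boundary circle.
`rot` sends a dart or leg to the counterclockwise next one with the same origin. -/
structure RotationSystem (D : Type*) (n : ℕ) where
  rev : Equiv.Perm D
  rev_rev : ∀ d, rev (rev d) = d
  rev_ne : ∀ d, rev d ≠ d
  rot : Equiv.Perm (D ⊕ Fin n)
  conductance : D → ℝ
  conductance_pos : ∀ d, 0 < conductance d
  conductance_rev : ∀ d, conductance (rev d) = conductance d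

namespace RotationSystem

variable {D : Type*} {n : ℕ}

/-- Vertices are the cycles of `rot`. (With at least one node, every vertex of a connected graph
is the origin of some dart or leg.) -/
def Vertex (G : RotationSystem D n) : Type _ := Quotient (Equiv.Perm.SameCycle.setoid G.rot)

/-- The vertex at which a dart or leg starts. -/
def vertex (G : RotationSystem D n) (h : D ⊕ Fin n) : G.Vertex :=
  Quotient.mk (Equiv.Perm.SameCycle.setoid G.rot) h

/-- Undirected edges (without the legs). -/
def Edge (G : RotationSystem D n) : Type _ := Quotient (Equiv.Perm.SameCycle.setoid G.rev)

/-- The walk along the boundary of the region on the left of a dart or leg. From the dart `d` it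
continues with the clockwise next of `rev d`. From the leg `i` it follows the boundary circle
counterclockwise to the end of leg `i + 1`, goes back along that leg, and continues with the
clockwise next of it. -/
def faceNext [NeZero n] (G : RotationSystem D n) : Equiv.Perm (D ⊕ Fin n) :=
  (Equiv.sumCongr G.rev (Equiv.addRight (1 : Fin n))).trans G.rot.symm

/-- Faces: the bounded faces of the graph, and the parts into which the legs cut the region
between the graph and the boundary circle. -/
def Face [NeZero n] (G : RotationSystem D n) : Type _ :=
  Quotient (Equiv.Perm.SameCycle.setoid G.faceNext)

/-- The face on the left of a dart or leg. -/
def face [NeZero n] (G : RotationSystem D n) (h : D ⊕ Fin n) : G.Face :=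
  Quotient.mk (Equiv.Perm.SameCycle.setoid G.faceNext) h

/-- The graph, without the legs, is connected. -/
def Connected (G : RotationSystem D n) : Prop :=
  ∀ v w : G.Vertex, Relation.ReflTransGen
    (fun x y => ∃ d : D, G.vertex (Sum.inl d) = x ∧ G.vertex (Sum.inl (G.rev d)) = y) v w

/-- A connected plane graph with distinct nodes on its outer face, numbered counterclockwise.
Planarity is Euler's formula for the connected map on the sphere obtained by contracting the
boundary circle to one vertex, in which the `n` legs end. -/
structure IsCircularPlanar [NeZero n] (G : RotationSystem D n) : Prop where
  connected : G.Connected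
  node_injective : Function.Injective fun i : Fin n => G.vertex (Sum.inr i)
  euler : ((Nat.card G.Vertex : ℤ) + 1) - ((Nat.card G.Edge : ℤ) + n) + (Nat.card G.Face : ℤ) = 2

/-- The graph itself as a resistor network: node `i` is the vertex that carries leg `i`. -/
def network (G : RotationSystem D n) : ResistorNetwork G.Vertex D (Fin n) where
  origin d := G.vertex (Sum.inl d)
  rev := G.rev
  rev_rev := G.rev_rev
  rev_ne := G.rev_ne
  conductance := G.conductance
  conductance_pos := G.conductance_pos
  conductance_rev := G.conductance_rev
  node i := G.vertex (Sum.inr i)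

/-- The dual network. Its vertices are the faces; each edge of the graph is crossed by one dual
edge, which joins the faces on its two sides and has the reciprocal conductance. The dual node
with index `i` is the face that lies at the boundary circle between the nodes `i` and `i + 1`. -/
noncomputable def dualNetwork [NeZero n] (G : RotationSystem D n) :
    ResistorNetwork G.Face D (Fin n) where
  origin d := G.face (Sum.inl d)
  rev := G.rev
  rev_rev := G.rev_rev
  rev_ne := G.rev_ne
  conductance d := (G.conductance d)⁻¹
  conductance_pos d := inv_pos.mpr (G.conductance_pos d)
  conductance_rev d := by rw [G.conductance_rev]
  node i := G.face (Sum.inr i)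

end RotationSystem

/-- The vector `δ_i - δ_{i+1}`, with `i + 1` taken cyclically. -/
def nodeDiff {n : ℕ} [NeZero n] (i : Fin n) : Fin n → ℝ := Pi.single i 1 - Pi.single (i + 1) 1

/-!
A harmonic potential `f` on the graph has a current flow, which becomes divergence free at every
vertex once the leg at each node carries the net current of that node away. On a connected map
with Euler characteristic `2` a dimension count shows that every divergence-free flow is the
difference of a potential `φ` on the faces across each edge and leg
(`exists_facePotential_of_divergence_eq_zero`). Ohm's law then exchanges the roles of the two
networks: the dual current driven by `φ` through a dual edge is, up to sign, the difference of `f`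
along the edge that it crosses. Around a face these differences telescope, so `φ` is harmonic for
the dual network and its net current at the dual node `i` is `f (i + 1) - f i`
(`netCurrent_dualNetwork`). If the net currents of `f` are `δ_j - δ_{j+1}`, then the difference of
`φ` across each leg shows that `φ` is a constant minus `δ_j` on the dual nodes
(`exists_conjugate`). As constants carry no current, the dual response matrix sends `δ_j` to
`i ↦ f i - f (i + 1)`, which is the formula.

Such an `f` exists for each `j`, because a current is driven by some potential as soon as its
total vanishes (`exists_netCurrent_eq`); the values of `φ` then also show that the dual nodes are
distinct faces. The response matrices exist and are unique because the Dirichlet problem on a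
connected network with distinct nodes is uniquely solvable (`exists_isHarmonic`). All statements
on solvability come down to the fact that a potential with vanishing energy is constant.
-/

/-! ### Connected resistor networks -/

namespace ResistorNetwork

variable {V D ι : Type*} [Fintype D]

/-- Connectedness, phrased through potentials: a potential that does not change along any edge is
constant. -/
def IsConnected (N : ResistorNetwork V D ι) : Prop :=
  ∀ f : V → ℝ, (∀ d, f (N.origin (N.rev d)) = f (N.origin d)) → ∀ v w, f v = f w

/-- The net current as a linear map in the potential. -/
noncomputable def netCurrentLinear (N : ResistorNetwork V D ι) : (V → ℝ) →ₗ[ℝ] (V → ℝ) where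
  toFun := N.netCurrent
  map_add' f g := by
    funext v
    simp only [netCurrent, Pi.add_apply, ← Finset.sum_add_distrib]
    refine Finset.sum_congr rfl fun d _ => ?_
    split_ifs <;> ring
  map_smul' a f := by
    funext v
    simp only [netCurrent, Pi.smul_apply, smul_eq_mul, RingHom.id_apply, Finset.mul_sum]
    refine Finset.sum_congr rfl fun d _ => ?_
    split_ifs <;> ring

@[simp] lemma netCurrentLinear_apply (N : ResistorNetwork V D ι) (f : V → ℝ) :
    N.netCurrentLinear f = N.netCurrent f := rfl

lemma sum_comp_rev (N : ResistorNetwork V D ι) (g : D → ℝ) : ∑ d, g (N.rev d) = ∑ d, g d :=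
  Equiv.sum_comp (Function.Involutive.toPerm N.rev N.rev_rev) g

lemma netCurrent_const (N : ResistorNetwork V D ι) (a : ℝ) (v : V) :
    N.netCurrent (fun _ => a) v = 0 := by
  simp [netCurrent]

/-- The linear operator of the Dirichlet problem: the potential at the nodes and the net current
at the internal vertices. -/
noncomputable def dirichletLinear (N : ResistorNetwork V D ι) : (V → ℝ) →ₗ[ℝ] (V → ℝ) := by
  classical
  exact LinearMap.pi fun v => if v ∈ Set.range N.node then LinearMap.proj v else
    (LinearMap.proj v).comp N.netCurrentLinear

lemma dirichletLinear_apply_node (N : ResistorNetwork V D ι) (f : V → ℝ) (i : ι) :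
    N.dirichletLinear f (N.node i) = f (N.node i) := by
  simp [dirichletLinear]

lemma dirichletLinear_apply_of_notMem (N : ResistorNetwork V D ι) (f : V → ℝ) {v : V}
    (hv : v ∉ Set.range N.node) : N.dirichletLinear f v = N.netCurrent f v := by
  simp only [dirichletLinear, LinearMap.pi_apply, if_neg hv]
  rfl

variable [Fintype V]

/-- Green's identity: the pairing of a potential with a net current is a symmetric form. -/
lemma sum_mul_netCurrent (N : ResistorNetwork V D ι) (g f : V → ℝ) :
    2 * ∑ v, g v * N.netCurrent f v =
      -∑ d, N.conductance d * (g (N.origin (N.rev d)) - g (N.origin d)) *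
        (f (N.origin (N.rev d)) - f (N.origin d)) := by
  classical
  have h1 : ∑ v, g v * N.netCurrent f v = ∑ d, g (N.origin d) *
      (N.conductance d * (f (N.origin (N.rev d)) - f (N.origin d))) := by
    simp only [netCurrent, Finset.mul_sum]
    rw [Finset.sum_comm]
    refine Finset.sum_congr rfl fun d _ => ?_
    rw [Finset.sum_eq_single (N.origin d)]
    · simp
    · intro v _ hv
      simp [Ne.symm hv]
    · simp
  have h2 := N.sum_comp_rev fun d => g (N.origin d) *
      (N.conductance d * (f (N.origin (N.rev d)) - f (N.origin d)))
  rw [two_mul, h1]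
  nth_rewrite 1 [← h2]
  rw [← Finset.sum_add_distrib, ← Finset.sum_neg_distrib]
  refine Finset.sum_congr rfl fun d _ => ?_
  simp only [N.rev_rev, N.conductance_rev]
  ring

lemma sum_netCurrent (N : ResistorNetwork V D ι) (f : V → ℝ) : ∑ v, N.netCurrent f v = 0 := by
  simpa using N.sum_mul_netCurrent (fun _ => 1) f

/-- A potential of vanishing energy is constant. -/
lemma IsConnected.eq_of_energy_eq_zero {N : ResistorNetwork V D ι} (hN : N.IsConnected)
    {f : V → ℝ} (hf : ∑ v, f v * N.netCurrent f v = 0) (v w : V) : f v = f w := by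
  refine hN f (fun d => ?_) v w
  have h := N.sum_mul_netCurrent f f
  rw [hf, mul_zero, eq_comm, neg_eq_zero, Finset.sum_eq_zero_iff_of_nonneg] at h
  · have hd := h d (Finset.mem_univ d)
    rw [mul_assoc, mul_eq_zero, mul_self_eq_zero, sub_eq_zero] at hd
    exact hd.resolve_left (N.conductance_pos d).ne'
  · intro d _
    rw [mul_assoc]
    exact mul_nonneg (N.conductance_pos d).le (mul_self_nonneg _)

/-- Every distribution of currents with total zero is the net current of some potential. -/
lemma IsConnected.exists_netCurrent_eq {N : ResistorNetwork V D ι} (hN : N.IsConnected)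
    {g : V → ℝ} (hg : ∑ v, g v = 0) : ∃ f, N.netCurrent f = g := by
  classical
  rcases isEmpty_or_nonempty V with hV | ⟨⟨v₀⟩⟩
  · exact ⟨g, Subsingleton.elim _ _⟩
  -- Grounding the network at `v₀` makes the Laplacian injective.
  let T : (V → ℝ) →ₗ[ℝ] (V → ℝ) := N.netCurrentLinear +
    (LinearMap.single ℝ (fun _ : V => ℝ) v₀).comp (LinearMap.proj v₀)
  have hT : ∀ f, T f = N.netCurrent f + Pi.single v₀ (f v₀) := fun f => rfl
  have hsum : ∀ f, ∑ v, T f v = f v₀ := fun f => by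
    simp [hT, Finset.sum_add_distrib, sum_netCurrent]
  have hinj : Function.Injective T := by
    rw [← LinearMap.ker_eq_bot, LinearMap.ker_eq_bot']
    intro f hf
    have h0 : f v₀ = 0 := by rw [← hsum f, hf]; simp
    have hc : N.netCurrent f = 0 := by simpa [hT, h0] using hf
    funext v
    rw [hN.eq_of_energy_eq_zero (f := f) (by simp [hc]) v v₀, h0]
    rfl
  obtain ⟨f, hf⟩ := LinearMap.injective_iff_surjective.mp hinj g
  have h0 : f v₀ = 0 := by rw [← hsum f, hf, hg]
  exact ⟨f, by simpa [hT, h0] using hf⟩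

/-- Uniqueness in the Dirichlet problem. -/
lemma IsConnected.dirichletLinear_injective [Nonempty ι] {N : ResistorNetwork V D ι}
    (hN : N.IsConnected) : Function.Injective N.dirichletLinear := by
  rw [← LinearMap.ker_eq_bot, LinearMap.ker_eq_bot']
  intro f hf
  have hnode : ∀ i, f (N.node i) = 0 := fun i => by
    rw [← N.dirichletLinear_apply_node f, hf]; rfl
  have henergy : ∑ v, f v * N.netCurrent f v = 0 := by
    refine Finset.sum_eq_zero fun v _ => ?_
    by_cases hv : v ∈ Set.range N.node
    · obtain ⟨i, rfl⟩ := hv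
      rw [hnode, zero_mul]
    · rw [← N.dirichletLinear_apply_of_notMem f hv, hf, Pi.zero_apply, mul_zero]
  funext v
  rw [hN.eq_of_energy_eq_zero henergy v (N.node (Classical.arbitrary ι)), hnode]
  rfl

/-- A linear choice of solutions of the Dirichlet problem. -/
lemma IsConnected.exists_isHarmonic_linear [Nonempty ι] {N : ResistorNetwork V D ι}
    (hN : N.IsConnected) (hnode : Function.Injective N.node) :
    ∃ H : (ι → ℝ) →ₗ[ℝ] (V → ℝ), ∀ u, N.IsHarmonic (H u) ∧ ∀ i, H u (N.node i) = u i := by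
  let e := LinearEquiv.ofInjectiveEndo N.dirichletLinear hN.dirichletLinear_injective
  have he : ∀ g, N.dirichletLinear (e.symm g) = g := fun g => e.apply_symm_apply g
  refine ⟨e.symm.toLinearMap.comp (Function.ExtendByZero.linearMap ℝ N.node), fun u => ⟨?_, ?_⟩⟩
  · intro v hv
    rw [← N.dirichletLinear_apply_of_notMem _ hv]
    exact (congrFun (he _) v).trans (Function.extend_apply' _ _ _ hv)
  · intro i
    exact (N.dirichletLinear_apply_node _ i).symm.trans
      ((congrFun (he _) _).trans (hnode.extend_apply _ _ i))

lemma IsConnected.exists_isHarmonic [Nonempty ι] {N : ResistorNetwork V D ι}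
    (hN : N.IsConnected) (hnode : Function.Injective N.node) (u : ι → ℝ) :
    ∃ f, N.IsHarmonic f ∧ ∀ i, f (N.node i) = u i :=
  let ⟨H, hH⟩ := hN.exists_isHarmonic_linear hnode
  ⟨H u, hH u⟩

lemma IsConnected.existsUnique_isResponseMatrix [Nonempty ι] [Fintype ι]
    {N : ResistorNetwork V D ι} (hN : N.IsConnected) (hnode : Function.Injective N.node) :
    ∃! L : Matrix ι ι ℝ, N.IsResponseMatrix L := by
  classical
  obtain ⟨H, hH⟩ := hN.exists_isHarmonic_linear hnode
  refine ⟨LinearMap.toMatrix' ((LinearMap.funLeft ℝ ℝ N.node).comp (N.netCurrentLinear.comp H)),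
    fun f hf => ?_, fun L hL => ?_⟩
  · have hfH : H (fun i => f (N.node i)) = f := by
      apply hN.dirichletLinear_injective
      funext v
      by_cases hv : v ∈ Set.range N.node
      · obtain ⟨i, rfl⟩ := hv
        rw [dirichletLinear_apply_node, dirichletLinear_apply_node, (hH _).2]
      · rw [dirichletLinear_apply_of_notMem _ _ hv, dirichletLinear_apply_of_notMem _ _ hv,
          hf v hv, (hH _).1 v hv]
    rw [LinearMap.toMatrix'_mulVec]
    funext i
    simp [LinearMap.funLeft, hfH]
  · apply Matrix.mulVec_injective
    funext u
    have h := hL (H u) (hH u).1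
    simp only [(hH u).2] at h
    rw [LinearMap.toMatrix'_mulVec]
    exact h

end ResistorNetwork

/-! ### Flows on a rotation system -/

/-- The increments of a function along a permutation sum to zero over each cycle. -/
lemma Equiv.Perm.sum_sub_cycle_eq_zero {H : Type*} [Fintype H] (π : Equiv.Perm H)
    (q : Quotient (Equiv.Perm.SameCycle.setoid π)) (p : H → ℝ)
    [DecidablePred fun h => (Quotient.mk (Equiv.Perm.SameCycle.setoid π) h) = q] :
    (∑ h, if Quotient.mk (Equiv.Perm.SameCycle.setoid π) h = q then p (π h) - p h else 0) = 0 := by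
  have hπ : ∀ h, Quotient.mk (Equiv.Perm.SameCycle.setoid π) (π h) =
      Quotient.mk (Equiv.Perm.SameCycle.setoid π) h := fun h =>
    Quotient.sound (Equiv.Perm.sameCycle_apply_left.mpr (Equiv.Perm.SameCycle.refl π h))
  have hs := Equiv.sum_comp π fun h =>
    if Quotient.mk (Equiv.Perm.SameCycle.setoid π) h = q then p h else 0
  simp only [hπ] at hs
  rw [← sub_eq_zero, ← Finset.sum_sub_distrib] at hs
  refine Eq.trans (Finset.sum_congr rfl fun h _ => ?_) hs
  split_ifs <;> simp

lemma Function.Injective.sum_ite_eq {ι X : Type*} [Fintype ι] [DecidableEq X] {p : ι → X}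
    (hp : Function.Injective p) (b : ι → ℝ) (i : ι) :
    (∑ k, if p k = p i then b k else 0) = b i := by
  classical
  simp [hp.eq_iff]

lemma Fin.apply_eq_apply_zero {n : ℕ} [NeZero n] {u : Fin n → ℝ} (hu : ∀ k, u (k + 1) = u k)
    (k : Fin n) : u k = u 0 := by
  cases n with
  | zero => exact k.elim0
  | succ m =>
    induction k using Fin.induction with
    | zero => rfl
    | succ k ih => rw [← Fin.coeSucc_eq_succ, hu, ih]

namespace RotationSystem

variable {D : Type*} {n : ℕ}

lemma vertex_rot (G : RotationSystem D n) (h : D ⊕ Fin n) : G.vertex (G.rot h) = G.vertex h :=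
  Quotient.sound (Equiv.Perm.sameCycle_apply_left.mpr (Equiv.Perm.SameCycle.refl G.rot h))

instance [Finite D] (G : RotationSystem D n) : Finite G.Vertex :=
  inferInstanceAs (Finite (Quotient _))

instance [Finite D] (G : RotationSystem D n) : Finite G.Edge :=
  inferInstanceAs (Finite (Quotient _))

/-- A potential on the darts and legs that is invariant under rotation and reversal is constant. -/
lemma Connected.eq_of_invariant {G : RotationSystem D n} (hG : G.Connected) {ψ : D ⊕ Fin n → ℝ}
    (hrot : ∀ h, ψ (G.rot h) = ψ h) (hrev : ∀ d, ψ (Sum.inl (G.rev d)) = ψ (Sum.inl d))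
    (h k : D ⊕ Fin n) : ψ h = ψ k := by
  have hpow : ∀ (m : ℕ) x, ψ ((G.rot ^ m) x) = ψ x := fun m => by
    induction m with
    | zero => simp
    | succ m ih => intro x; rw [pow_succ', Equiv.Perm.mul_apply, hrot, ih]
  have hcyc : ∀ x y, G.rot.SameCycle x y → ψ x = ψ y := by
    rintro x y ⟨m, rfl⟩
    obtain ⟨m, rfl | rfl⟩ := m.eq_nat_or_neg
    · simp [hpow]
    · simpa using hpow m ((G.rot ^ (-(m : ℤ))) x)
  let f : G.Vertex → ℝ := Quotient.lift ψ hcyc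
  have key : ∀ v w, Relation.ReflTransGen
      (fun x y => ∃ d : D, G.vertex (Sum.inl d) = x ∧ G.vertex (Sum.inl (G.rev d)) = y) v w →
      f v = f w := by
    intro v w hvw
    induction hvw with
    | refl => rfl
    | tail _ hstep ih =>
      obtain ⟨d, rfl, rfl⟩ := hstep
      exact ih.trans (hrev d).symm
  exact key (G.vertex h) (G.vertex k) (hG _ _)

lemma Connected.network_isConnected {G : RotationSystem D n} [Fintype D] (hG : G.Connected) :
    G.network.IsConnected := by
  intro f hf v w
  obtain ⟨h, rfl⟩ := Quotient.exists_rep v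
  obtain ⟨k, rfl⟩ := Quotient.exists_rep w
  exact hG.eq_of_invariant (ψ := fun h => f (G.vertex h)) (fun h => by rw [vertex_rot]) hf h k

/-- The flows: functions on darts and legs that change sign when a dart is reversed. The value at
a leg is the flow from the node to the boundary circle. -/
def flow (G : RotationSystem D n) : Submodule ℝ (D ⊕ Fin n → ℝ) where
  carrier := {ω | ∀ d, ω (Sum.inl (G.rev d)) = -ω (Sum.inl d)}
  add_mem' hx hy d := by simp only [Pi.add_apply, hx d, hy d]; ring
  zero_mem' d := by simp
  smul_mem' a x hx d := by simp only [Pi.smul_apply, hx d, smul_neg]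

open Classical in
/-- The total flow out of each vertex through its darts and legs. -/
noncomputable def divergence [Fintype D] (G : RotationSystem D n) :
    (D ⊕ Fin n → ℝ) →ₗ[ℝ] (G.Vertex → ℝ) where
  toFun ω v := ∑ h, if G.vertex h = v then ω h else 0
  map_add' x y := by
    funext v
    simp only [Pi.add_apply, ← Finset.sum_add_distrib]
    exact Finset.sum_congr rfl fun h _ => by split_ifs <;> ring
  map_smul' a x := by
    funext v
    simp only [Pi.smul_apply, smul_eq_mul, RingHom.id_apply, Finset.mul_sum]
    exact Finset.sum_congr rfl fun h _ => by split_ifs <;> ring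

open Classical in
lemma divergence_apply [Fintype D] (G : RotationSystem D n) (ω : D ⊕ Fin n → ℝ) (v : G.Vertex) :
    G.divergence ω v = (∑ d, if G.vertex (Sum.inl d) = v then ω (Sum.inl d) else 0) +
      ∑ k, if G.vertex (Sum.inr k) = v then ω (Sum.inr k) else 0 :=
  Fintype.sum_sum_type _

/-- The flow of a potential on the edges, with the given flow on the legs. -/
def currentFlow (G : RotationSystem D n) (f : G.Vertex → ℝ) (b : Fin n → ℝ) : D ⊕ Fin n → ℝ :=
  Sum.elim (fun d => G.conductance d *
    (f (G.vertex (Sum.inl (G.rev d))) - f (G.vertex (Sum.inl d)))) b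

lemma currentFlow_mem_flow (G : RotationSystem D n) (f : G.Vertex → ℝ) (b : Fin n → ℝ) :
    G.currentFlow f b ∈ G.flow := by
  intro d
  simp only [currentFlow, Sum.elim_inl, G.rev_rev, G.conductance_rev]
  ring

open Classical in
lemma divergence_currentFlow [Fintype D] (G : RotationSystem D n) (f : G.Vertex → ℝ)
    (b : Fin n → ℝ) (v : G.Vertex) : G.divergence (G.currentFlow f b) v =
      G.network.netCurrent f v + ∑ k, if G.vertex (Sum.inr k) = v then b k else 0 := by
  rw [divergence_apply]
  congr 1
  refine Finset.sum_congr rfl fun d _ => ?_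
  change _ = if G.vertex (Sum.inl d) = v then
    G.conductance d * (f (G.vertex (Sum.inl (G.rev d))) - f v) else 0
  split_ifs with h
  · rw [← h]; rfl
  · rfl

/-- The total of an arbitrary divergence can be absorbed by a single leg. -/
lemma Connected.exists_flow_divergence_eq [Fintype D] [NeZero n] {G : RotationSystem D n}
    (hG : G.Connected) (g : G.Vertex → ℝ) : ∃ ω ∈ G.flow, G.divergence ω = g := by
  classical
  have := Fintype.ofFinite G.Vertex
  let v₀ := G.vertex (Sum.inr 0)
  obtain ⟨f, hf⟩ := hG.network_isConnected.exists_netCurrent_eq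
    (g := g - Pi.single v₀ (∑ v, g v)) (by simp [Finset.sum_sub_distrib])
  refine ⟨G.currentFlow f (Pi.single 0 (∑ v, g v)), currentFlow_mem_flow _ _ _, ?_⟩
  funext v
  rw [divergence_currentFlow, hf, Finset.sum_eq_single (0 : Fin n)]
  · by_cases hv : v = v₀
    · subst hv; simp [v₀]
    · have hv' : G.vertex (Sum.inr 0) ≠ v := Ne.symm hv
      simp [hv, hv']
  · intro k _ hk
    simp [hk]
  · simp

lemma eq_or_eq_rev_of_sameCycle (G : RotationSystem D n) {d e : D} (h : G.rev.SameCycle d e) :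
    e = d ∨ e = G.rev d := by
  obtain ⟨m, rfl⟩ := h
  have h2 : G.rev ^ (2 : ℤ) = 1 := by
    ext d
    simp [zpow_ofNat, pow_two, G.rev_rev]
  obtain ⟨k, rfl | rfl⟩ := m.even_or_odd'
  · left; simp [zpow_mul, h2]
  · right; simp [zpow_add, zpow_mul, h2]

/-- A flow is determined by its values on one dart from each edge and on the legs. -/
lemma finrank_flow_le [Finite D] (G : RotationSystem D n) :
    Module.finrank ℝ G.flow ≤ Nat.card G.Edge + n := by
  classical
  have := Fintype.ofFinite G.Edge
  have := Fintype.ofFinite D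
  let r : G.Edge ⊕ Fin n → D ⊕ Fin n := Sum.map Quotient.out id
  let R : G.flow →ₗ[ℝ] (G.Edge ⊕ Fin n → ℝ) := (LinearMap.funLeft ℝ ℝ r).comp G.flow.subtype
  have hR : Function.Injective R := by
    rw [← LinearMap.ker_eq_bot, LinearMap.ker_eq_bot']
    rintro ⟨ω, hω⟩ h0
    have h0' : ∀ x, ω (r x) = 0 := fun x => congrFun h0 x
    ext x
    rcases x with d | k
    · have hd : G.rev.SameCycle (Quotient.out (Quotient.mk (Equiv.Perm.SameCycle.setoid G.rev) d))
        d := Quotient.mk_out (s := Equiv.Perm.SameCycle.setoid G.rev) d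
      have hz : ω (Sum.inl (Quotient.out (Quotient.mk (Equiv.Perm.SameCycle.setoid G.rev) d))) = 0 :=
        h0' (Sum.inl (Quotient.mk (Equiv.Perm.SameCycle.setoid G.rev) d))
      rcases G.eq_or_eq_rev_of_sameCycle hd with h | h
      · rw [← h] at hz
        exact hz
      · have := hω (Quotient.out (Quotient.mk (Equiv.Perm.SameCycle.setoid G.rev) d))
        rw [← h, hz, neg_zero] at this
        exact this
    · exact h0' (Sum.inr k)
  have := LinearMap.finrank_le_finrank_of_injective hR
  simpa [Nat.card_eq_fintype_card] using this

/-! ### Potentials on the faces -/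

variable [NeZero n]

instance [Finite D] (G : RotationSystem D n) : Finite G.Face :=
  inferInstanceAs (Finite (Quotient _))

lemma face_faceNext (G : RotationSystem D n) (h : D ⊕ Fin n) :
    G.face (G.faceNext h) = G.face h :=
  Quotient.sound (Equiv.Perm.sameCycle_apply_left.mpr (Equiv.Perm.SameCycle.refl G.faceNext h))

/-- The dart or leg whose face lies on the right of the given one: the reverse of a dart, and the
previous leg for a leg. -/
def rightPerm (G : RotationSystem D n) : Equiv.Perm (D ⊕ Fin n) :=
  (Equiv.sumCongr G.rev (Equiv.addRight (1 : Fin n))).symm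

lemma rightPerm_inl (G : RotationSystem D n) (d : D) :
    G.rightPerm (Sum.inl d) = Sum.inl (G.rev d) := by
  have : G.rev.symm d = G.rev d := by rw [Equiv.symm_apply_eq, G.rev_rev]
  simp [rightPerm, this]

lemma rightPerm_inr (G : RotationSystem D n) (k : Fin n) :
    G.rightPerm (Sum.inr k) = Sum.inr (k - 1) := by
  simp [rightPerm, sub_eq_add_neg]

/-- Two successive darts or legs at a vertex border a common face. -/
lemma face_rightPerm_rot (G : RotationSystem D n) (h : D ⊕ Fin n) :
    G.face (G.rightPerm (G.rot h)) = G.face h := by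
  rw [← face_faceNext, faceNext, rightPerm, Equiv.trans_apply, Equiv.apply_symm_apply,
    Equiv.symm_apply_apply]

lemma vertex_faceNext_inl (G : RotationSystem D n) (d : D) :
    G.vertex (G.faceNext (Sum.inl d)) = G.vertex (Sum.inl (G.rev d)) := by
  rw [← vertex_rot]
  simp [faceNext]

lemma vertex_faceNext_inr (G : RotationSystem D n) (k : Fin n) :
    G.vertex (G.faceNext (Sum.inr k)) = G.vertex (Sum.inr (k + 1)) := by
  rw [← vertex_rot]
  simp [faceNext]

/-- The difference of a potential on the faces across each dart and leg, left minus right. -/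
def faceDiff (G : RotationSystem D n) : (G.Face → ℝ) →ₗ[ℝ] (D ⊕ Fin n → ℝ) where
  toFun φ h := φ (G.face h) - φ (G.face (G.rightPerm h))
  map_add' x y := by funext h; simp only [Pi.add_apply]; ring
  map_smul' a x := by funext h; simp only [Pi.smul_apply, smul_eq_mul, RingHom.id_apply]; ring

lemma faceDiff_apply (G : RotationSystem D n) (φ : G.Face → ℝ) (h : D ⊕ Fin n) :
    G.faceDiff φ h = φ (G.face h) - φ (G.face (G.rightPerm h)) := rfl

lemma faceDiff_mem_flow (G : RotationSystem D n) (φ : G.Face → ℝ) : G.faceDiff φ ∈ G.flow := by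
  intro d
  simp only [faceDiff_apply, rightPerm_inl, G.rev_rev]
  ring

lemma divergence_faceDiff [Fintype D] (G : RotationSystem D n) (φ : G.Face → ℝ) :
    G.divergence (G.faceDiff φ) = 0 := by
  classical
  funext v
  have h := Equiv.Perm.sum_sub_cycle_eq_zero G.rot v fun h => φ (G.face (G.rightPerm h))
  simp only [face_rightPerm_rot] at h
  rw [Pi.zero_apply, ← h]
  rfl

lemma Connected.eq_of_faceDiff_eq_zero {G : RotationSystem D n} (hG : G.Connected)
    {φ : G.Face → ℝ} (hφ : G.faceDiff φ = 0) (x y : G.Face) : φ x = φ y := by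
  have h0 : ∀ h, φ (G.face h) = φ (G.face (G.rightPerm h)) := fun h =>
    sub_eq_zero.mp (congrFun hφ h)
  obtain ⟨h, rfl⟩ := Quotient.exists_rep x
  obtain ⟨k, rfl⟩ := Quotient.exists_rep y
  refine hG.eq_of_invariant (ψ := fun h => φ (G.face h)) (fun h => ?_) (fun d => ?_) h k
  · rw [h0, face_rightPerm_rot]
  · rw [h0 (Sum.inl d), rightPerm_inl]

lemma Connected.card_face_le [Finite D] {G : RotationSystem D n} (hG : G.Connected) :
    Nat.card G.Face ≤ Module.finrank ℝ (LinearMap.range G.faceDiff) + 1 := by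
  have := Fintype.ofFinite G.Face
  have hker : Module.finrank ℝ (LinearMap.ker G.faceDiff) ≤ 1 := by
    have hle : LinearMap.ker G.faceDiff ≤ Submodule.span ℝ {fun _ : G.Face => (1 : ℝ)} := by
      intro φ hφ
      rw [Submodule.mem_span_singleton]
      refine ⟨φ (G.face (Sum.inr 0)), funext fun x => ?_⟩
      simpa using hG.eq_of_faceDiff_eq_zero hφ (G.face (Sum.inr 0)) x
    exact (Submodule.finrank_mono hle).trans (by simpa using finrank_span_le_card (R := ℝ) {fun _ : G.Face => (1 : ℝ)})
  have := G.faceDiff.finrank_range_add_finrank_ker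
  rw [Module.finrank_fintype_fun_eq_card] at this
  rw [Nat.card_eq_fintype_card]
  omega

/-- On a circular planar graph every divergence-free flow comes from a potential on the faces: by
Euler's formula the space of such flows is no larger than that of face differences. -/
lemma IsCircularPlanar.exists_facePotential_of_divergence_eq_zero [Fintype D]
    {G : RotationSystem D n} (hG : G.IsCircularPlanar) {ω : D ⊕ Fin n → ℝ} (hω : ω ∈ G.flow)
    (hdiv : G.divergence ω = 0) : ∃ φ, G.faceDiff φ = ω := by
  have := Fintype.ofFinite G.Vertex
  let δ : G.flow →ₗ[ℝ] (G.Vertex → ℝ) := G.divergence.comp G.flow.subtype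
  have hsurj : Function.Surjective δ := fun g =>
    let ⟨ω, hω, h⟩ := hG.connected.exists_flow_divergence_eq g
    ⟨⟨ω, hω⟩, h⟩
  have hrank := δ.finrank_range_add_finrank_ker
  rw [LinearMap.range_eq_top.mpr hsurj, finrank_top, Module.finrank_fintype_fun_eq_card,
    ← Nat.card_eq_fintype_card] at hrank
  let K := (LinearMap.ker δ).map G.flow.subtype
  have hK : Module.finrank ℝ K = Module.finrank ℝ (LinearMap.ker δ) :=
    (Submodule.equivMapOfInjective _ G.flow.injective_subtype _).finrank_eq.symm
  have hle : LinearMap.range G.faceDiff ≤ K := by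
    rintro _ ⟨φ, rfl⟩
    exact ⟨⟨G.faceDiff φ, G.faceDiff_mem_flow φ⟩, G.divergence_faceDiff φ, rfl⟩
  have hE := G.finrank_flow_le
  have hF := hG.connected.card_face_le
  have heuler := hG.euler
  have heq := Submodule.eq_of_le_of_finrank_le hle (by omega)
  have hmem : ω ∈ K := ⟨⟨ω, hω⟩, hdiv, rfl⟩
  rw [← heq] at hmem
  exact hmem

/-! ### The conjugate potential -/

/-- The dual network is connected: the faces around a node can be reached from each other without
crossing its leg, since the differences of a potential around the node sum to zero. -/
lemma IsCircularPlanar.dualNetwork_isConnected [Fintype D] {G : RotationSystem D n}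
    (hG : G.IsCircularPlanar) : G.dualNetwork.IsConnected := by
  classical
  intro φ hφ
  have hdart : ∀ d, G.faceDiff φ (Sum.inl d) = 0 := fun d => by
    rw [faceDiff_apply, rightPerm_inl]
    exact sub_eq_zero.mpr (hφ d).symm
  refine hG.connected.eq_of_faceDiff_eq_zero ?_
  funext h
  rcases h with d | k
  · exact hdart d
  · have h := congrFun (G.divergence_faceDiff φ) (G.vertex (Sum.inr k))
    rw [divergence_apply, Finset.sum_eq_zero fun d _ => by simp [hdart], zero_add] at h
    exact (hG.node_injective.sum_ite_eq _ k).symm.trans h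

/-- A potential `φ` on the faces is conjugate to a potential `f` on the vertices when the current
of `f` along each dart is the difference of `φ` across it. -/
def IsConjugate (G : RotationSystem D n) (f : G.Vertex → ℝ) (φ : G.Face → ℝ) : Prop :=
  ∀ d, G.conductance d * (f (G.vertex (Sum.inl (G.rev d))) - f (G.vertex (Sum.inl d))) =
    φ (G.face (Sum.inl d)) - φ (G.face (Sum.inl (G.rev d)))

/-- A potential with net currents `δ_j - δ_{j+1}` at the nodes has a conjugate potential, which
is a constant minus `δ_j` at the dual nodes. -/
lemma IsCircularPlanar.exists_conjugate [Fintype D] {G : RotationSystem D n}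
    (hG : G.IsCircularPlanar) {f : G.Vertex → ℝ} {j : Fin n} (hf : G.network.IsHarmonic f)
    (hj : ∀ k, G.network.netCurrent f (G.network.node k) = nodeDiff j k) :
    ∃ φ, G.IsConjugate f φ ∧
      ∃ a : ℝ, ∀ k, φ (G.face (Sum.inr k)) = a - (Pi.single j 1 : Fin n → ℝ) k := by
  classical
  obtain ⟨φ, hφ⟩ := hG.exists_facePotential_of_divergence_eq_zero
    (G.currentFlow_mem_flow f (-nodeDiff j)) (by
      funext v
      rw [divergence_currentFlow]
      by_cases hv : v ∈ Set.range G.network.node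
      · obtain ⟨k, rfl⟩ := hv
        have h := hG.node_injective.sum_ite_eq (-nodeDiff j) k
        rw [hj]
        exact (congrArg _ h).trans (add_neg_cancel _)
      · have hne : ∀ k, G.vertex (Sum.inr k) ≠ v := fun k e => hv ⟨k, e⟩
        simp [hf v hv, hne])
  refine ⟨φ, fun d => ?_, ?_⟩
  · have h := congrFun hφ (Sum.inl d)
    rw [faceDiff_apply, rightPerm_inl] at h
    exact h.symm
  · have hstep : ∀ k, φ (G.face (Sum.inr (k + 1))) + (Pi.single j 1 : Fin n → ℝ) (k + 1) =
        φ (G.face (Sum.inr k)) + (Pi.single j 1 : Fin n → ℝ) k := fun k => by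
      have h := congrFun hφ (Sum.inr (k + 1))
      rw [faceDiff_apply, rightPerm_inr, add_sub_cancel_right] at h
      have hs : (Pi.single (j + 1) 1 : Fin n → ℝ) (k + 1) = (Pi.single j 1 : Fin n → ℝ) k := by
        simp [Pi.single_apply]
      simp only [currentFlow, Sum.elim_inr, Pi.neg_apply, nodeDiff, Pi.sub_apply, hs] at h
      linarith
    refine ⟨φ (G.face (Sum.inr 0)) + (Pi.single j 1 : Fin n → ℝ) 0, fun k => ?_⟩
    rw [← Fin.apply_eq_apply_zero (u := fun k => φ (G.face (Sum.inr k)) +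
      (Pi.single j 1 : Fin n → ℝ) k) hstep k, add_sub_cancel_right]

/-- Some potential drives the current `δ_j - δ_{j+1}` through the nodes. -/
lemma IsCircularPlanar.exists_netCurrent_eq_nodeDiff [Fintype D] {G : RotationSystem D n}
    (hG : G.IsCircularPlanar) (j : Fin n) : ∃ f, G.network.IsHarmonic f ∧
      ∀ k, G.network.netCurrent f (G.network.node k) = nodeDiff j k := by
  classical
  have := Fintype.ofFinite G.Vertex
  let g : G.Vertex → ℝ := Pi.single (G.network.node j) 1 - Pi.single (G.network.node (j + 1)) 1
  obtain ⟨f, hf⟩ := hG.connected.network_isConnected.exists_netCurrent_eq (g := g)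
    (by simp [g, Finset.sum_sub_distrib])
  have hinj : Function.Injective G.network.node := hG.node_injective
  refine ⟨f, fun v hv => ?_, fun k => ?_⟩
  · have h1 : ∀ k, v ≠ G.network.node k := fun k e => hv ⟨k, e.symm⟩
    rw [hf]
    simp [g, h1]
  · rw [hf]
    simp [g, nodeDiff, Pi.single_apply, hinj.eq_iff]

/-- The dual nodes are distinct, as they are separated by conjugate potentials. -/
lemma IsCircularPlanar.dualNetwork_node_injective [Fintype D] {G : RotationSystem D n}
    (hG : G.IsCircularPlanar) : Function.Injective G.dualNetwork.node := by
  intro i j hij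
  by_contra hne
  obtain ⟨f, hf, hj⟩ := hG.exists_netCurrent_eq_nodeDiff j
  obtain ⟨φ, -, a, ha⟩ := hG.exists_conjugate hf hj
  have hi := ha i
  rw [show G.face (Sum.inr i) = G.face (Sum.inr j) from hij, ha j] at hi
  simp [hne] at hi

open Classical in
/-- The dual net current of a conjugate potential at a face is the sum of the increments of `f`
along those parts of the boundary of the face that lie on the boundary circle. -/
lemma IsConjugate.netCurrent_dualNetwork [Fintype D] {G : RotationSystem D n} {f : G.Vertex → ℝ}
    {φ : G.Face → ℝ} (h : G.IsConjugate f φ) (x : G.Face) :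
    G.dualNetwork.netCurrent φ x = ∑ k, if G.face (Sum.inr k) = x then
      f (G.vertex (Sum.inr (k + 1))) - f (G.vertex (Sum.inr k)) else 0 := by
  have hcycle := Equiv.Perm.sum_sub_cycle_eq_zero G.faceNext x fun h => f (G.vertex h)
  rw [Fintype.sum_sum_type] at hcycle
  simp only [vertex_faceNext_inl, vertex_faceNext_inr] at hcycle
  rw [← neg_eq_iff_add_eq_zero, ← Finset.sum_neg_distrib] at hcycle
  refine Eq.trans (Finset.sum_congr rfl fun d _ => ?_) hcycle
  change (if G.face (Sum.inl d) = x then (G.conductance d)⁻¹ *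
    (φ (G.face (Sum.inl (G.rev d))) - φ x) else 0) = -(if G.face (Sum.inl d) = x then _ else 0)
  split_ifs with hx
  · rw [← hx, ← neg_sub (φ (G.face (Sum.inl d))), ← h d, mul_neg,
      inv_mul_cancel_left₀ (G.conductance_pos d).ne']
  · simp

end RotationSystem

open RotationSystem in
theorem lemma4p1 {D : Type*} [Fintype D] {n : ℕ} [NeZero n] (G : RotationSystem D n)
    (hG : G.IsCircularPlanar) :
    (∃! L : Matrix (Fin n) (Fin n) ℝ, G.network.IsResponseMatrix L) ∧
    (∃! Ldual : Matrix (Fin n) (Fin n) ℝ, G.dualNetwork.IsResponseMatrix Ldual) ∧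
    ∀ L Ldual : Matrix (Fin n) (Fin n) ℝ,
      G.network.IsResponseMatrix L → G.dualNetwork.IsResponseMatrix Ldual →
      (∀ j, ∃ w, L *ᵥ w = nodeDiff j) ∧
      (∀ i v, L *ᵥ v = 0 → nodeDiff i ⬝ᵥ v = 0) ∧
      (∀ i j w, L *ᵥ w = nodeDiff j → Ldual i j = nodeDiff i ⬝ᵥ w) := by
  classical
  have := Fintype.ofFinite G.Vertex
  have := Fintype.ofFinite G.Face
  have hconn := hG.connected.network_isConnected
  have hnode : Function.Injective G.network.node := hG.node_injective
  have hdual := hG.dualNetwork_node_injective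
  refine ⟨hconn.existsUnique_isResponseMatrix hnode,
    hG.dualNetwork_isConnected.existsUnique_isResponseMatrix hdual, fun L Ldual hL hLdual => ?_⟩
  have hdot : ∀ (i : Fin n) (v : Fin n → ℝ), nodeDiff i ⬝ᵥ v = v i - v (i + 1) := fun i v => by
    simp [nodeDiff, sub_dotProduct]
  refine ⟨fun j => ?_, fun i v hv => ?_, fun i j w hw => ?_⟩
  · obtain ⟨f, hf, hj⟩ := hG.exists_netCurrent_eq_nodeDiff j
    exact ⟨_, (hL f hf).trans (funext hj)⟩
  · obtain ⟨f, hf, hfv⟩ := hconn.exists_isHarmonic hnode v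
    have h := hL f hf
    simp only [hfv, hv] at h
    have hzero : ∀ x, G.network.netCurrent f x = 0 := fun x => by
      by_cases hx : x ∈ Set.range G.network.node
      · obtain ⟨k, rfl⟩ := hx
        exact (congrFun h k).symm
      · exact hf x hx
    rw [hdot, ← hfv, ← hfv, hconn.eq_of_energy_eq_zero (f := f) (by simp [hzero]) (G.network.node i)
      (G.network.node (i + 1)), sub_self]
  · obtain ⟨f, hf, hfw⟩ := hconn.exists_isHarmonic hnode w
    have h := hL f hf
    simp only [hfw, hw] at h
    obtain ⟨φ, hφ, a, ha⟩ := hG.exists_conjugate hf fun k => (congrFun h k).symm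
    have hφh : G.dualNetwork.IsHarmonic φ := fun x hx => by
      rw [hφ.netCurrent_dualNetwork]
      exact Finset.sum_eq_zero fun k _ => if_neg fun e => hx ⟨k, e⟩
    have hφi : G.dualNetwork.netCurrent φ (G.dualNetwork.node i) = w (i + 1) - w i := by
      rw [hφ.netCurrent_dualNetwork, ← hfw, ← hfw]
      exact hdual.sum_ite_eq (fun k => f (G.vertex (Sum.inr (k + 1))) - f (G.vertex (Sum.inr k))) i
    have h1 := congrFun (hLdual φ hφh) i
    have h2 := congrFun (hLdual (fun _ => a) fun x _ => G.dualNetwork.netCurrent_const a x) i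
    rw [ResistorNetwork.netCurrent_const] at h2
    have h3 : (fun k => φ (G.dualNetwork.node k)) = (fun _ => a) - Pi.single j 1 := funext ha
    rw [h3, Matrix.mulVec_sub, Pi.sub_apply, h2, hφi, Matrix.mulVec_single_one] at h1
    rw [hdot]
    simp only [Matrix.col_apply] at h1
    linarith
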